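/- Let $d \ge 0$ be an integer, let $\mathbb{S}^d = \{x \in \mathbb{R}^{d+1} : \|x\| = 1\}$ be the unit sphere, let $\mathcal{P}(\mathbb{S}^d)$ be the set of Borel probability measures on $\mathbb{S}^d$, and let $\alpha > 0$. For $\mu \in \mathcal{P}(\mathbb{S}^d)$ put $$\mathcal{L}_\alpha(\mu) = \int_{\mathbb{S}^d} \log\left( \int_{\mathbb{S}^d} e^{\alpha(\langle x, y\rangle - 1)}\, \mu(\mathrm{d}y) \right) \mu(\mathrm{d}x).$$ Then the variational problem $$\inf_{\mu \in \mathcal{P}(\mathbb{S}^d)} \mathcal{L}_\alpha(\mu)$$ has a unique minimizer, and it is the uniform probability measure on $\mathbb{S}^d$ (normalized surface measure). That is, $\mu \in \mathcal{P}(\mathbb{S}^d)$ satisfies $\mathcal{L}_\alpha(\mu) \le \mathcal{L}_\alpha(\nu)$ for all $\nu \in \mathcal{P}(\mathbb{S}^d)$ if and only if $\mu$ is the uniform probability measure. -/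

import Mathlib

open MeasureTheory

noncomputable section

/-- The unit sphere `𝕊^d` of the Euclidean space `ℝ^(d+1)`. -/
abbrev USphere (d : ℕ) : Type :=
  Metric.sphere (0 : EuclideanSpace ℝ (Fin (d + 1))) 1

/-- The kernel `e^{α(⟨x,y⟩ - 1)}` on `𝕊^d`. -/
def sphereKernel {d : ℕ} (α : ℝ) (x y : USphere d) : ℝ :=
  Real.exp (α * (inner ℝ (x : EuclideanSpace ℝ (Fin (d + 1))) y - 1))

/-- `𝓛_α(μ) = ∫ log (∫ e^{α(⟨x,y⟩ - 1)} μ(dy)) μ(dx)` for a probability measure `μ` on `𝕊^d`.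
Both integrals converge for every `μ` (`integrable_sphereKernel`, `integrable_log_potential`). -/
def sphereLoss {d : ℕ} (α : ℝ) (μ : ProbabilityMeasure (USphere d)) : ℝ :=
  ∫ x, Real.log (∫ y, sphereKernel α x y ∂(μ : Measure (USphere d))) ∂(μ : Measure (USphere d))

theorem sphereKernel_bounds {d : ℕ} (α : ℝ) (x y : USphere d) :
    Real.exp (-(2 * |α|)) ≤ sphereKernel α x y ∧ sphereKernel α x y ≤ Real.exp (2 * |α|) := by
  have h := abs_real_inner_le_norm (x : EuclideanSpace ℝ (Fin (d + 1))) y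
  rw [norm_eq_of_mem_sphere, norm_eq_of_mem_sphere, mul_one] at h
  have h2 : |inner ℝ (x : EuclideanSpace ℝ (Fin (d + 1))) y - 1| ≤ 2 := by
    rw [abs_le] at h ⊢
    constructor <;> linarith [h.1, h.2]
  have h3 : |α * (inner ℝ (x : EuclideanSpace ℝ (Fin (d + 1))) y - 1)| ≤ 2 * |α| := by
    rw [abs_mul, mul_comm]
    exact mul_le_mul_of_nonneg_right h2 (abs_nonneg _)
  rw [abs_le] at h3
  exact ⟨Real.exp_le_exp.2 h3.1, Real.exp_le_exp.2 h3.2⟩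

theorem continuous_sphereKernel {d : ℕ} (α : ℝ) :
    Continuous (fun p : USphere d × USphere d => sphereKernel α p.1 p.2) := by
  unfold sphereKernel
  fun_prop

/-- The inner integral converges. -/
theorem integrable_sphereKernel {d : ℕ} (α : ℝ) (μ : ProbabilityMeasure (USphere d))
    (x : USphere d) :
    Integrable (fun y => sphereKernel α x y) (μ : Measure (USphere d)) := by
  refine Integrable.of_bound (C := Real.exp (2 * |α|)) ?_ ?_
  · exact ((continuous_sphereKernel α).comp (by fun_prop :
      Continuous fun y : USphere d => (x, y))).aestronglyMeasurable
  · refine Filter.Eventually.of_forall fun y => ?_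
    have h := sphereKernel_bounds α x y
    rw [Real.norm_of_nonneg ((Real.exp_pos _).le.trans h.1)]
    exact h.2

/-- The outer integral converges. -/
theorem integrable_log_potential {d : ℕ} (α : ℝ) (μ : ProbabilityMeasure (USphere d)) :
    Integrable (fun x => Real.log (∫ y, sphereKernel α x y ∂(μ : Measure (USphere d))))
      (μ : Measure (USphere d)) := by
  refine Integrable.of_bound (C := 2 * |α|) ?_ ?_
  · have h : StronglyMeasurable
        (fun x => ∫ y, sphereKernel α x y ∂(μ : Measure (USphere d))) :=
      (continuous_sphereKernel α).stronglyMeasurable.integral_prod_right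
    exact (Real.measurable_log.comp h.measurable).aestronglyMeasurable
  · refine Filter.Eventually.of_forall fun x => ?_
    have hlo : Real.exp (-(2 * |α|)) ≤ ∫ y, sphereKernel α x y ∂(μ : Measure (USphere d)) := by
      have := integral_mono (integrable_const _) (integrable_sphereKernel α μ x)
        (fun y => (sphereKernel_bounds α x y).1)
      simpa using this
    have hhi : ∫ y, sphereKernel α x y ∂(μ : Measure (USphere d)) ≤ Real.exp (2 * |α|) := by
      have := integral_mono (integrable_sphereKernel α μ x) (integrable_const _)
        (fun y => (sphereKernel_bounds α x y).2)
      simpa using this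
    have hpos := (Real.exp_pos _).trans_le hlo
    rw [Real.norm_eq_abs, abs_le]
    exact ⟨(Real.le_log_iff_exp_le hpos).2 hlo, (Real.log_le_iff_le_exp hpos).2 hhi⟩

/-- The uniform probability measure on `𝕊^d`: the surface measure of the sphere induced by
Lebesgue measure, divided by its total mass. -/
def uniformSphere (d : ℕ) : ProbabilityMeasure (USphere d) :=
  ⟨((volume : Measure (EuclideanSpace ℝ (Fin (d + 1)))).toSphere Set.univ)⁻¹ •
      (volume : Measure (EuclideanSpace ℝ (Fin (d + 1)))).toSphere,
    ⟨by
      rw [Measure.smul_apply, smul_eq_mul]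
      exact ENNReal.inv_mul_cancel
        (fun h => Measure.toSphere_ne_zero _ (Measure.measure_univ_eq_zero.1 h))
        (measure_ne_top _ _)⟩⟩

end

/-! Write `g x z` for `gaussianFeature`, `m μ z` for its μ-average and γ for the standard Gaussian.
The kernel factors as K(x,y) = ∫ g x · g y dγ, so the potential is P_μ(x) = ∫ g x · m μ dγ. By
symmetry the uniform measure ν has constant potential c; nothing else about it is used.

With f = m μ / m ν, the probability measure (g x · m ν / c) dγ has f-mean P_μ(x)/c, so Jensen and
log f ≥ 1 - 1/f give log (P_μ(x)/c) ≥ 1 - c⁻¹ ∫ g x (m ν)² / m μ dγ. Integrating against μ(dx) turns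
g x into m μ, which cancels the denominator; what remains is ∫ (m ν)² dγ = ∫∫ K dν dν = c. Hence
L(μ) ≥ log c = L(ν).

`featureGap` is the pointwise form of this bound, and its double integral is c (L(μ) - L(ν))
(`integral_integral_featureGap`). Equality forces f = 1 almost everywhere, and mean features
determine the measure (`eq_of_meanFeature_ae_eq`). -/

open ProbabilityTheory Real
open scoped RealInnerProductSpace Pointwise

/-! ### Exponential moments of the standard Gaussian -/

section Gaussian

variable {E : Type*} [NormedAddCommGroup E] [InnerProductSpace ℝ E] [FiniteDimensional ℝ E]
  [MeasurableSpace E] [BorelSpace E]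

theorem mgf_strongDual_stdGaussian (L : StrongDual ℝ E) (t : ℝ) :
    mgf L (stdGaussian E) t = exp (‖L‖ ^ 2 * t ^ 2 / 2) := by
  rw [mgf_gaussianReal (IsGaussian.map_eq_gaussianReal (μ := stdGaussian E) L),
    integral_strongDual_stdGaussian, variance_dual_stdGaussian, zero_mul, zero_add,
    Real.coe_toNNReal _ (sq_nonneg _)]

theorem integral_exp_inner_stdGaussian (v : E) :
    ∫ z, exp ⟪v, z⟫ ∂(stdGaussian E) = exp (‖v‖ ^ 2 / 2) := by
  have h := mgf_strongDual_stdGaussian (innerSL ℝ v) 1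
  simpa [mgf] using h

/-- Fernique's theorem gives an integrable exp (C‖z‖²), and completing the square bounds c‖z‖ by
C‖z‖² plus a constant. -/
theorem integrable_exp_mul_norm_stdGaussian (c : ℝ) :
    Integrable (fun z => exp (c * ‖z‖)) (stdGaussian E) := by
  obtain ⟨C, hC, hint⟩ := IsGaussian.exists_integrable_exp_sq (stdGaussian E)
  refine (hint.const_mul (exp (c ^ 2 / (4 * C)))).mono' (by fun_prop) (.of_forall fun z => ?_)
  rw [norm_of_nonneg (exp_pos _).le, ← exp_add, exp_le_exp]
  have h : c ^ 2 / (4 * C) + C * ‖z‖ ^ 2 - c * ‖z‖ = C * (‖z‖ - c / (2 * C)) ^ 2 := by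
    field_simp
    ring
  have : 0 ≤ C * (‖z‖ - c / (2 * C)) ^ 2 := by positivity
  linarith

end Gaussian

/-! ### Rotation invariance and the constant potential of the uniform measure -/

section Rotation

variable {d : ℕ}

/-- The action of a linear isometry on the unit sphere. -/
noncomputable def sphereMap (f : EuclideanSpace ℝ (Fin (d + 1)) ≃ₗᵢ[ℝ] EuclideanSpace ℝ (Fin (d + 1)))
    (x : USphere d) : USphere d :=
  ⟨f x, by rw [mem_sphere_zero_iff_norm, f.norm_map, norm_eq_of_mem_sphere]⟩

theorem continuous_sphereMap
    (f : EuclideanSpace ℝ (Fin (d + 1)) ≃ₗᵢ[ℝ] EuclideanSpace ℝ (Fin (d + 1))) :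
    Continuous (sphereMap f) :=
  (f.continuous.comp continuous_subtype_val).subtype_mk _

/-- The surface measure of a set is a multiple of the volume of the cone over it; isometries commute
with coning and preserve volume. -/
theorem map_sphereMap_toSphere
    (f : EuclideanSpace ℝ (Fin (d + 1)) ≃ₗᵢ[ℝ] EuclideanSpace ℝ (Fin (d + 1))) :
    ((volume : Measure (EuclideanSpace ℝ (Fin (d + 1)))).toSphere).map (sphereMap f) =
      (volume : Measure (EuclideanSpace ℝ (Fin (d + 1)))).toSphere := by
  ext s hs
  have hm := (continuous_sphereMap f).measurable
  rw [Measure.map_apply hm hs, Measure.toSphere_apply' _ (hm hs), Measure.toSphere_apply' _ hs]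
  congr 1
  rw [← f.measurePreserving.measure_preimage_emb f.toHomeomorph.measurableEmbedding
    (Set.Ioo (0 : ℝ) 1 • (Subtype.val '' s))]
  congr 1
  ext v
  simp only [Set.mem_smul, Set.mem_image, Set.mem_preimage]
  constructor
  · rintro ⟨r, hr, _, ⟨x, hx, rfl⟩, rfl⟩
    exact ⟨r, hr, _, ⟨_, hx, rfl⟩, (f.map_smul r _).symm⟩
  · rintro ⟨r, hr, _, ⟨x, hx, rfl⟩, h⟩
    refine ⟨r, hr, _, ⟨sphereMap f.symm x, ?_, rfl⟩, ?_⟩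
    · convert hx
      exact Subtype.ext (f.apply_symm_apply _)
    · apply f.injective
      rw [← h, f.map_smul]
      exact congrArg (r • ·) (f.apply_symm_apply _)

theorem map_sphereMap_uniformSphere
    (f : EuclideanSpace ℝ (Fin (d + 1)) ≃ₗᵢ[ℝ] EuclideanSpace ℝ (Fin (d + 1))) :
    (uniformSphere d : Measure (USphere d)).map (sphereMap f) = uniformSphere d := by
  change (_ • _ : Measure (USphere d)).map _ = _ • _
  rw [Measure.map_smul, map_sphereMap_toSphere]

/-- The reflection in the hyperplane orthogonal to x - y carries x to y and preserves both the
kernel and the measure. -/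
theorem integral_sphereKernel_uniformSphere (α : ℝ) (x y : USphere d) :
    ∫ w, sphereKernel α x w ∂(uniformSphere d : Measure (USphere d)) =
      ∫ w, sphereKernel α y w ∂(uniformSphere d : Measure (USphere d)) := by
  let f := (ℝ ∙ ((x : EuclideanSpace ℝ (Fin (d + 1))) - y))ᗮ.reflection
  have hf : f x = y := by
    apply Submodule.reflection_sub
    rw [norm_eq_of_mem_sphere, norm_eq_of_mem_sphere]
  conv_rhs => rw [← map_sphereMap_uniformSphere f]
  have hc : Continuous fun w : USphere d => sphereKernel α y w :=
    (continuous_sphereKernel α).comp (by fun_prop : Continuous fun w : USphere d => (y, w))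
  rw [integral_map (continuous_sphereMap f).aemeasurable hc.aestronglyMeasurable]
  refine integral_congr_ae (.of_forall fun w => ?_)
  simp only [sphereKernel]
  rw [← hf]
  change _ = exp (α * (⟪f x, f w⟫ - 1))
  rw [f.inner_map_map]

end Rotation

/-! ### Exponential moments determine a measure on the sphere -/

section Determination

variable {d : ℕ}

theorem integrable_exp_inner_sphere (μ : ProbabilityMeasure (USphere d))
    (v : EuclideanSpace ℝ (Fin (d + 1))) :
    Integrable (fun y : USphere d => exp ⟪v, (y : EuclideanSpace ℝ (Fin (d + 1)))⟫)
      (μ : Measure (USphere d)) :=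
  Continuous.integrable_of_hasCompactSupport (by fun_prop) (HasCompactSupport.of_compactSpace _)

/-- A probability measure on the sphere is determined by its moment generating function. -/
theorem ext_of_integral_exp_inner_sphere {μ ν : ProbabilityMeasure (USphere d)}
    (h : ∀ v : EuclideanSpace ℝ (Fin (d + 1)),
      ∫ y : USphere d, exp ⟪v, (y : EuclideanSpace ℝ (Fin (d + 1)))⟫ ∂(μ : Measure (USphere d)) =
        ∫ y : USphere d, exp ⟪v, (y : EuclideanSpace ℝ (Fin (d + 1)))⟫ ∂(ν : Measure (USphere d))) :
    μ = ν := by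
  have hsub : MeasurableEmbedding
      (Subtype.val : USphere d → EuclideanSpace ℝ (Fin (d + 1))) :=
    MeasurableEmbedding.subtype_coe Metric.isClosed_sphere.measurableSet
  have key : (μ : Measure (USphere d)).map Subtype.val =
      (ν : Measure (USphere d)).map (Subtype.val : _ → EuclideanSpace ℝ (Fin (d + 1))) := by
    apply Measure.ext_of_charFun
    ext v
    have hmgf : mgf (fun y : USphere d => ⟪v, (y : EuclideanSpace ℝ (Fin (d + 1)))⟫)
        (μ : Measure (USphere d)) = mgf (fun y : USphere d =>
          ⟪v, (y : EuclideanSpace ℝ (Fin (d + 1)))⟫) (ν : Measure (USphere d)) := by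
      ext t
      simpa only [mgf, real_inner_smul_left] using h (t • v)
    have hset : integrableExpSet (fun y : USphere d => ⟪v, (y : EuclideanSpace ℝ (Fin (d + 1)))⟫)
        (μ : Measure (USphere d)) = Set.univ := by
      refine Set.eq_univ_of_forall fun t => ?_
      simpa only [integrableExpSet, Set.mem_ofPred_eq, real_inner_smul_left] using
        integrable_exp_inner_sphere μ (t • v)
    -- Analytic continuation from the real axis to the point i turns equality of the MGFs into
    -- equality of characteristic functions.
    have hI := eqOn_complexMGF_of_mgf hmgf (x := Complex.I) (by simp [hset])
    rw [charFun_apply, charFun_apply, integral_map (by fun_prop) (by fun_prop),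
      integral_map (by fun_prop) (by fun_prop)]
    simpa only [complexMGF, mul_comm Complex.I, real_inner_comm v] using hI
  apply Subtype.ext
  have := congrArg
    (Measure.comap (Subtype.val : USphere d → EuclideanSpace ℝ (Fin (d + 1)))) key
  rw [hsub.comap_map, hsub.comap_map] at this
  exact this

end Determination

/-! ### Gaussian factorization of the kernel -/

section Feature

variable {d : ℕ} {α : ℝ}

instance isProbabilityMeasure_stdGaussian_euclideanSpace (n : ℕ) :
    IsProbabilityMeasure (stdGaussian (EuclideanSpace ℝ (Fin n))) :=
  isProbabilityMeasure_stdGaussian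

instance sFinite_stdGaussian_euclideanSpace (n : ℕ) :
    SFinite (stdGaussian (EuclideanSpace ℝ (Fin n))) :=
  inferInstance

/-- The Gaussian features: `∫ gaussianFeature α x z * gaussianFeature α y z` over a standard
Gaussian vector `z` is `sphereKernel α x y`. -/
noncomputable def gaussianFeature (α : ℝ) (v z : EuclideanSpace ℝ (Fin (d + 1))) : ℝ :=
  exp (-α + √α * ⟪v, z⟫)

/-- The average of the Gaussian features over a measure on the sphere. -/
noncomputable def meanFeature (α : ℝ) (μ : ProbabilityMeasure (USphere d))
    (z : EuclideanSpace ℝ (Fin (d + 1))) : ℝ :=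
  ∫ y : USphere d, gaussianFeature α (y : EuclideanSpace ℝ (Fin (d + 1))) z
    ∂(μ : Measure (USphere d))

theorem gaussianFeature_pos (v z : EuclideanSpace ℝ (Fin (d + 1))) :
    0 < gaussianFeature α v z := exp_pos _

theorem continuous_gaussianFeature :
    Continuous fun p : EuclideanSpace ℝ (Fin (d + 1)) × EuclideanSpace ℝ (Fin (d + 1)) =>
      gaussianFeature α p.1 p.2 := by
  unfold gaussianFeature
  fun_prop

theorem gaussianFeature_le (v z : EuclideanSpace ℝ (Fin (d + 1))) :
    gaussianFeature α v z ≤ exp (-α + √α * (‖v‖ * ‖z‖)) := by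
  unfold gaussianFeature
  gcongr
  exact real_inner_le_norm v z

theorem le_gaussianFeature (x : USphere d) (z : EuclideanSpace ℝ (Fin (d + 1))) :
    exp (-α - √α * ‖z‖) ≤ gaussianFeature α x z := by
  unfold gaussianFeature
  have h := (abs_le.1 (abs_real_inner_le_norm (x : EuclideanSpace ℝ (Fin (d + 1))) z)).1
  rw [norm_eq_of_mem_sphere, one_mul] at h
  have := mul_le_mul_of_nonneg_left h (sqrt_nonneg α)
  rw [exp_le_exp]
  linarith

theorem gaussianFeature_sphere_le (x : USphere d) (z : EuclideanSpace ℝ (Fin (d + 1))) :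
    gaussianFeature α x z ≤ exp (-α + √α * ‖z‖) := by
  simpa using gaussianFeature_le (α := α) (x : EuclideanSpace ℝ (Fin (d + 1))) z

theorem integrable_gaussianFeature_sphere (μ : ProbabilityMeasure (USphere d))
    (z : EuclideanSpace ℝ (Fin (d + 1))) :
    Integrable (fun y : USphere d => gaussianFeature α (y : EuclideanSpace ℝ (Fin (d + 1))) z)
      (μ : Measure (USphere d)) :=
  (continuous_gaussianFeature.comp (by fun_prop : Continuous fun y : USphere d =>
    ((y : EuclideanSpace ℝ (Fin (d + 1))), z))).integrable_of_hasCompactSupport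
      (HasCompactSupport.of_compactSpace _)

theorem le_meanFeature (μ : ProbabilityMeasure (USphere d))
    (z : EuclideanSpace ℝ (Fin (d + 1))) : exp (-α - √α * ‖z‖) ≤ meanFeature α μ z := by
  simpa [meanFeature] using integral_mono (integrable_const _) (integrable_gaussianFeature_sphere μ z)
    (fun y => le_gaussianFeature y z)

theorem meanFeature_le (μ : ProbabilityMeasure (USphere d))
    (z : EuclideanSpace ℝ (Fin (d + 1))) : meanFeature α μ z ≤ exp (-α + √α * ‖z‖) := by
  simpa [meanFeature] using integral_mono (integrable_gaussianFeature_sphere μ z) (integrable_const _)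
    (fun y => gaussianFeature_sphere_le y z)

theorem meanFeature_pos (μ : ProbabilityMeasure (USphere d))
    (z : EuclideanSpace ℝ (Fin (d + 1))) : 0 < meanFeature α μ z :=
  (exp_pos _).trans_le (le_meanFeature μ z)

theorem measurable_meanFeature (μ : ProbabilityMeasure (USphere d)) :
    Measurable (meanFeature α μ) := by
  have h : StronglyMeasurable fun p : EuclideanSpace ℝ (Fin (d + 1)) × USphere d =>
      gaussianFeature α (p.2 : EuclideanSpace ℝ (Fin (d + 1))) p.1 :=
    (continuous_gaussianFeature.comp (by fun_prop : Continuous fun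
      p : EuclideanSpace ℝ (Fin (d + 1)) × USphere d =>
        ((p.2 : EuclideanSpace ℝ (Fin (d + 1))), p.1))).stronglyMeasurable
  exact h.integral_prod_right.measurable

theorem integral_gaussianFeature_mul (hα : 0 < α) (v w : EuclideanSpace ℝ (Fin (d + 1))) :
    ∫ z, gaussianFeature α v z * gaussianFeature α w z ∂(stdGaussian _) =
      exp (-(2 * α) + α * ‖v + w‖ ^ 2 / 2) := by
  have h : ∀ z, gaussianFeature α v z * gaussianFeature α w z =
      exp (-(2 * α)) * exp ⟪√α • (v + w), z⟫ := fun z => by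
    rw [gaussianFeature, gaussianFeature, ← exp_add, ← exp_add, real_inner_smul_left,
      inner_add_left]
    ring_nf
  simp_rw [h]
  rw [integral_const_mul, integral_exp_inner_stdGaussian, ← exp_add, norm_smul,
    norm_of_nonneg (sqrt_nonneg α), mul_pow, sq_sqrt hα.le]

theorem integral_gaussianFeature_mul_sphere (hα : 0 < α) (x y : USphere d) :
    ∫ z, gaussianFeature α (x : EuclideanSpace ℝ (Fin (d + 1))) z *
      gaussianFeature α (y : EuclideanSpace ℝ (Fin (d + 1))) z ∂(stdGaussian _) =
      sphereKernel α x y := by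
  rw [integral_gaussianFeature_mul hα, sphereKernel, norm_add_sq_real, norm_eq_of_mem_sphere,
    norm_eq_of_mem_sphere]
  ring_nf

/-- A measurable function on `USphere d × ℝ^(d+1)` of at most exponential growth is integrable. -/
theorem integrable_prod_of_exp_bound (μ : ProbabilityMeasure (USphere d))
    {F : USphere d × EuclideanSpace ℝ (Fin (d + 1)) → ℝ} (hF : Measurable F) (a b : ℝ)
    (hb : ∀ p, |F p| ≤ exp (a + b * ‖p.2‖)) :
    Integrable F ((μ : Measure (USphere d)).prod (stdGaussian _)) := by
  have h := ((integrable_exp_mul_norm_stdGaussian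
    (E := EuclideanSpace ℝ (Fin (d + 1))) b).const_mul (exp a)).comp_snd
      (μ : Measure (USphere d))
  refine h.mono' hF.aestronglyMeasurable (.of_forall fun p => ?_)
  rw [norm_eq_abs, ← exp_add]
  exact hb p

theorem integral_gaussianFeature_mul_meanFeature (μ : ProbabilityMeasure (USphere d))
    (v : EuclideanSpace ℝ (Fin (d + 1))) :
    ∫ z, gaussianFeature α v z * meanFeature α μ z ∂(stdGaussian _) =
      ∫ y : USphere d, ∫ z, gaussianFeature α v z *
        gaussianFeature α (y : EuclideanSpace ℝ (Fin (d + 1))) z ∂(stdGaussian _)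
          ∂(μ : Measure (USphere d)) := by
  have hv : Continuous fun p : USphere d × EuclideanSpace ℝ (Fin (d + 1)) =>
      gaussianFeature α v p.2 * gaussianFeature α (p.1 : EuclideanSpace ℝ (Fin (d + 1))) p.2 := by
    unfold gaussianFeature
    fun_prop
  have hint := integrable_prod_of_exp_bound μ hv.measurable (-(2 * α)) (√α * (‖v‖ + 1))
    fun p => by
      rw [abs_of_pos (mul_pos (gaussianFeature_pos _ _) (gaussianFeature_pos _ _))]
      refine (mul_le_mul (gaussianFeature_le v p.2) (gaussianFeature_sphere_le p.1 p.2)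
        (gaussianFeature_pos _ _).le (exp_pos _).le).trans_eq ?_
      rw [← exp_add]
      ring_nf
  rw [integral_integral_swap hint]
  simp_rw [integral_const_mul]
  rfl

theorem integral_gaussianFeature_mul_meanFeature_sphere (hα : 0 < α)
    (μ : ProbabilityMeasure (USphere d)) (x : USphere d) :
    ∫ z, gaussianFeature α (x : EuclideanSpace ℝ (Fin (d + 1))) z * meanFeature α μ z
      ∂(stdGaussian _) = ∫ y, sphereKernel α x y ∂(μ : Measure (USphere d)) := by
  rw [integral_gaussianFeature_mul_meanFeature]
  simp_rw [integral_gaussianFeature_mul_sphere hα]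

/-- A probability measure on the sphere is determined by its mean Gaussian feature. -/
theorem eq_of_meanFeature_ae_eq (hα : 0 < α) {μ ν : ProbabilityMeasure (USphere d)}
    (h : meanFeature α μ =ᵐ[stdGaussian _] meanFeature α ν) : μ = ν := by
  refine ext_of_integral_exp_inner_sphere fun v => ?_
  -- Testing against the feature at a point off the sphere recovers every exponential moment: the
  -- scaling α⁻¹ cancels the α of the kernel, and ‖y‖ = 1 makes the remaining factor independent of
  -- y.
  have key : ∀ ρ : ProbabilityMeasure (USphere d),
      ∫ z, gaussianFeature α (α⁻¹ • v) z * meanFeature α ρ z ∂(stdGaussian _) =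
        exp (-(2 * α) + α * (‖α⁻¹ • v‖ ^ 2 + 1) / 2) *
          ∫ y : USphere d, exp ⟪v, (y : EuclideanSpace ℝ (Fin (d + 1)))⟫
            ∂(ρ : Measure (USphere d)) := fun ρ => by
    rw [integral_gaussianFeature_mul_meanFeature, ← integral_const_mul]
    refine integral_congr_ae (.of_forall fun y => ?_)
    simp only []
    rw [integral_gaussianFeature_mul hα, norm_add_sq_real, norm_eq_of_mem_sphere, ← exp_add,
      real_inner_smul_left]
    congr 1
    field_simp
    ring
  have hvw : ∫ z, gaussianFeature α (α⁻¹ • v) z * meanFeature α μ z ∂(stdGaussian _) =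
      ∫ z, gaussianFeature α (α⁻¹ • v) z * meanFeature α ν z ∂(stdGaussian _) :=
    integral_congr_ae (h.mono fun z hz => by simp only [hz])
  rw [key, key] at hvw
  exact mul_left_cancel₀ (exp_pos _).ne' hvw

end Feature

/-! ### The variational inequality and its equality case -/

section Minimization

variable {d : ℕ} {α : ℝ}

/-- Sum of log f ≥ 1 - 1/f and log (f/a) ≤ f/a - 1. The second is the tangent-line form of Jensen,
with a in the role of the mean of f. -/
theorem log_gap_nonneg {a f : ℝ} (ha : 0 < a) (hf : 0 < f) : 0 ≤ log a - 2 + f⁻¹ + f / a := by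
  have h1 := one_sub_inv_le_log_of_pos hf
  have h2 := log_le_sub_one_of_pos (div_pos hf ha)
  rw [log_div hf.ne' ha.ne'] at h2
  linarith

theorem eq_one_of_log_gap_eq_zero {a f : ℝ} (ha : 0 < a) (hf : 0 < f)
    (h : log a - 2 + f⁻¹ + f / a = 0) : f = 1 := by
  by_contra hne
  have h1 := log_lt_sub_one_of_pos (inv_pos.2 hf) (inv_ne_one.2 hne)
  have h2 := log_le_sub_one_of_pos (div_pos hf ha)
  rw [log_div hf.ne' ha.ne'] at h2
  rw [log_inv] at h1
  linarith

theorem potential_pos (μ : ProbabilityMeasure (USphere d)) (x : USphere d) :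
    0 < ∫ y, sphereKernel α x y ∂(μ : Measure (USphere d)) := by
  have := integral_mono (integrable_const _) (integrable_sphereKernel α μ x)
    (fun y => (sphereKernel_bounds α x y).1)
  refine (exp_pos (-(2 * |α|))).trans_le ?_
  simpa using this

/-- The integrand `g(x,z) ν(z)² / μ(z)` built from the Gaussian feature `g` and the mean features
of `ν` and `μ`. -/
noncomputable def featureRatio (α : ℝ) (μ ν : ProbabilityMeasure (USphere d))
    (p : USphere d × EuclideanSpace ℝ (Fin (d + 1))) : ℝ :=
  gaussianFeature α (p.1 : EuclideanSpace ℝ (Fin (d + 1))) p.2 *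
    (meanFeature α ν p.2 ^ 2 / meanFeature α μ p.2)

theorem measurable_featureRatio (μ ν : ProbabilityMeasure (USphere d)) :
    Measurable (featureRatio α μ ν) := by
  have hg : Continuous fun p : USphere d × EuclideanSpace ℝ (Fin (d + 1)) =>
      gaussianFeature α (p.1 : EuclideanSpace ℝ (Fin (d + 1))) p.2 := by
    unfold gaussianFeature
    fun_prop
  refine hg.measurable.mul ?_
  exact (((measurable_meanFeature ν).comp measurable_snd).pow_const 2).div
    ((measurable_meanFeature μ).comp measurable_snd)

theorem abs_featureRatio_le (μ ν : ProbabilityMeasure (USphere d))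
    (p : USphere d × EuclideanSpace ℝ (Fin (d + 1))) :
    |featureRatio α μ ν p| ≤ exp (-(2 * α) + 4 * √α * ‖p.2‖) := by
  have hν := meanFeature_pos (α := α) ν p.2
  have hμ := meanFeature_pos (α := α) μ p.2
  have hx := gaussianFeature_pos (α := α) (p.1 : EuclideanSpace ℝ (Fin (d + 1))) p.2
  unfold featureRatio
  rw [abs_of_pos (by positivity)]
  calc _ ≤ exp (-α + √α * ‖p.2‖) * (exp (-α + √α * ‖p.2‖) ^ 2 / exp (-α - √α * ‖p.2‖)) := by
        gcongr
        · exact gaussianFeature_sphere_le p.1 p.2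
        · exact meanFeature_le ν p.2
        · exact le_meanFeature μ p.2
    _ = _ := by
        rw [← exp_nat_mul, ← exp_sub, ← exp_add]
        congr 1
        push_cast
        ring

theorem integrable_featureRatio (μ ν : ProbabilityMeasure (USphere d)) :
    Integrable (featureRatio α μ ν) ((μ : Measure (USphere d)).prod (stdGaussian _)) :=
  integrable_prod_of_exp_bound μ (measurable_featureRatio μ ν) _ _ (abs_featureRatio_le μ ν)

theorem integrable_featureRatio_right (μ ν : ProbabilityMeasure (USphere d)) (x : USphere d) :
    Integrable (fun z => featureRatio α μ ν (x, z)) (stdGaussian _) := by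
  refine ((integrable_exp_mul_norm_stdGaussian (4 * √α)).const_mul (exp (-(2 * α)))).mono'
    ((measurable_featureRatio μ ν).comp measurable_prodMk_left).aestronglyMeasurable
    (.of_forall fun z => ?_)
  rw [norm_eq_abs, ← exp_add]
  exact abs_featureRatio_le μ ν (x, z)

theorem integrable_gaussianFeature_mul_meanFeature (μ : ProbabilityMeasure (USphere d))
    (x : USphere d) :
    Integrable (fun z => gaussianFeature α (x : EuclideanSpace ℝ (Fin (d + 1))) z *
      meanFeature α μ z) (stdGaussian _) := by
  convert integrable_featureRatio_right (α := α) μ μ x using 2 with z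
  have := (meanFeature_pos (α := α) μ z).ne'
  simp only [featureRatio]
  field_simp

/-- Integrating over x first produces a factor `meanFeature α μ z` that cancels the denominator, so
the value does not depend on μ. -/
theorem integral_integral_featureRatio (hα : 0 < α) (μ ν : ProbabilityMeasure (USphere d)) :
    ∫ x, ∫ z, featureRatio α μ ν (x, z) ∂(stdGaussian _) ∂(μ : Measure (USphere d)) =
      ∫ x, ∫ y, sphereKernel α x y ∂(ν : Measure (USphere d)) ∂(ν : Measure (USphere d)) := by
  have h : ∀ ρ τ : ProbabilityMeasure (USphere d),
      ∫ x, ∫ z, featureRatio α ρ τ (x, z) ∂(stdGaussian _) ∂(ρ : Measure (USphere d)) =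
        ∫ z, meanFeature α τ z ^ 2 ∂(stdGaussian _) := fun ρ τ => by
    rw [integral_integral_swap (f := fun x z => featureRatio α ρ τ (x, z))
      (integrable_featureRatio ρ τ)]
    refine integral_congr_ae (.of_forall fun z => ?_)
    have := (meanFeature_pos (α := α) ρ z).ne'
    simp only [featureRatio]
    rw [integral_mul_const]
    change meanFeature α ρ z * _ = _
    field_simp
  -- Since the outer measure is immaterial, replace it by ν; the ratio then collapses to g · m ν,
  -- whose Gaussian integral is the potential of ν.
  rw [h, ← h ν ν]
  refine integral_congr_ae (.of_forall fun x => ?_)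
  simp only []
  rw [← integral_gaussianFeature_mul_meanFeature_sphere hα]
  refine integral_congr_ae (.of_forall fun z => ?_)
  have := (meanFeature_pos (α := α) ν z).ne'
  simp only [featureRatio]
  field_simp

/-! ### The pointwise gap and its integrals -/

section Gap

variable (μ ν : ProbabilityMeasure (USphere d)) {c : ℝ}

/-- The pointwise gap in the Jensen-type bound for the logarithmic potential. -/
noncomputable def featureGap (α c : ℝ) (μ ν : ProbabilityMeasure (USphere d)) (x : USphere d)
    (z : EuclideanSpace ℝ (Fin (d + 1))) : ℝ :=
  gaussianFeature α (x : EuclideanSpace ℝ (Fin (d + 1))) z * meanFeature α ν z *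
    (log ((∫ y, sphereKernel α x y ∂(μ : Measure (USphere d))) / c) - 2 +
      (meanFeature α μ z / meanFeature α ν z)⁻¹ + meanFeature α μ z / meanFeature α ν z /
        ((∫ y, sphereKernel α x y ∂(μ : Measure (USphere d))) / c))

theorem featureGap_nonneg (hc : 0 < c) (x : USphere d) (z : EuclideanSpace ℝ (Fin (d + 1))) :
    0 ≤ featureGap α c μ ν x z :=
  mul_nonneg (mul_pos (gaussianFeature_pos _ _) (meanFeature_pos ν z)).le
    (log_gap_nonneg (div_pos (potential_pos μ x) hc)
      (div_pos (meanFeature_pos μ z) (meanFeature_pos ν z)))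

theorem meanFeature_eq_of_featureGap_eq_zero (hc : 0 < c) {x : USphere d}
    {z : EuclideanSpace ℝ (Fin (d + 1))} (h : featureGap α c μ ν x z = 0) :
    meanFeature α μ z = meanFeature α ν z := by
  have hν := meanFeature_pos (α := α) ν z
  rcases mul_eq_zero.1 h with h | h
  · exact absurd h (mul_pos (gaussianFeature_pos _ _) hν).ne'
  · have := eq_one_of_log_gap_eq_zero (div_pos (potential_pos μ x) hc)
      (div_pos (meanFeature_pos μ z) hν) h
    exact (div_eq_one_iff_eq hν.ne').1 this

theorem featureGap_eq (hc : 0 < c) (x : USphere d) (z : EuclideanSpace ℝ (Fin (d + 1))) :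
    featureGap α c μ ν x z =
      (log (∫ y, sphereKernel α x y ∂(μ : Measure (USphere d))) - log c - 2) *
          (gaussianFeature α (x : EuclideanSpace ℝ (Fin (d + 1))) z * meanFeature α ν z) +
        featureRatio α μ ν (x, z) +
        c / (∫ y, sphereKernel α x y ∂(μ : Measure (USphere d))) *
          (gaussianFeature α (x : EuclideanSpace ℝ (Fin (d + 1))) z * meanFeature α μ z) := by
  have hν := (meanFeature_pos (α := α) ν z).ne'
  have hμ := (meanFeature_pos (α := α) μ z).ne'
  have hP := (potential_pos (α := α) μ x).ne'
  rw [featureGap, log_div hP hc.ne', featureRatio]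
  field_simp

theorem integrable_featureGap (hc : 0 < c) (x : USphere d) :
    Integrable (featureGap α c μ ν x) (stdGaussian _) := by
  rw [funext (featureGap_eq μ ν hc x)]
  exact (((integrable_gaussianFeature_mul_meanFeature ν x).const_mul _).add
    (integrable_featureRatio_right μ ν x)).add
      ((integrable_gaussianFeature_mul_meanFeature μ x).const_mul _)

theorem integral_featureGap (hα : 0 < α) (hc : 0 < c) (x : USphere d)
    (hν : ∫ y, sphereKernel α x y ∂(ν : Measure (USphere d)) = c) :
    ∫ z, featureGap α c μ ν x z ∂(stdGaussian _) =
      c * log (∫ y, sphereKernel α x y ∂(μ : Measure (USphere d))) - (c * log c + c) +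
        ∫ z, featureRatio α μ ν (x, z) ∂(stdGaussian _) := by
  have hP := (potential_pos (α := α) μ x).ne'
  simp_rw [featureGap_eq μ ν hc x]
  have h1 := (integrable_gaussianFeature_mul_meanFeature (α := α) ν x).const_mul
    (log (∫ y, sphereKernel α x y ∂(μ : Measure (USphere d))) - log c - 2)
  have h2 := integrable_featureRatio_right (α := α) μ ν x
  have h3 := (integrable_gaussianFeature_mul_meanFeature (α := α) μ x).const_mul
    (c / ∫ y, sphereKernel α x y ∂(μ : Measure (USphere d)))
  rw [integral_add (h1.fun_add h2) h3, integral_add h1 h2, integral_const_mul, integral_const_mul,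
    integral_gaussianFeature_mul_meanFeature_sphere hα,
    integral_gaussianFeature_mul_meanFeature_sphere hα, hν, div_mul_cancel₀ _ hP]
  ring

theorem integrable_integral_featureGap (hα : 0 < α) (hc : 0 < c)
    (hν : ∀ x, ∫ y, sphereKernel α x y ∂(ν : Measure (USphere d)) = c) :
    Integrable (fun x => ∫ z, featureGap α c μ ν x z ∂(stdGaussian _))
      (μ : Measure (USphere d)) := by
  rw [funext fun x => integral_featureGap μ ν hα hc x (hν x)]
  exact (((integrable_log_potential α μ).const_mul c).sub (integrable_const _)).add
    (integrable_featureRatio μ ν).integral_prod_left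

theorem integral_integral_featureGap (hα : 0 < α) (hc : 0 < c)
    (hν : ∀ x, ∫ y, sphereKernel α x y ∂(ν : Measure (USphere d)) = c) :
    ∫ x, ∫ z, featureGap α c μ ν x z ∂(stdGaussian _) ∂(μ : Measure (USphere d)) =
      c * (sphereLoss α μ - sphereLoss α ν) := by
  have h1 := (integrable_log_potential α μ).const_mul c
  have h2 := (integrable_featureRatio (α := α) μ ν).integral_prod_left
  rw [funext fun x => integral_featureGap μ ν hα hc x (hν x),
    integral_add (h1.sub' (integrable_const _)) h2, integral_sub h1 (integrable_const _),
    integral_const_mul, integral_integral_featureRatio hα]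
  simp only [sphereLoss, hν, integral_const, probReal_univ, one_smul]
  ring

end Gap

/-- A probability measure with constant potential minimizes `sphereLoss`. -/
theorem sphereLoss_le_of_potential_const (hα : 0 < α) {c : ℝ} (hc : 0 < c)
    (μ ν : ProbabilityMeasure (USphere d))
    (hν : ∀ x, ∫ y, sphereKernel α x y ∂(ν : Measure (USphere d)) = c) :
    sphereLoss α ν ≤ sphereLoss α μ := by
  have h : 0 ≤ c * (sphereLoss α μ - sphereLoss α ν) := by
    rw [← integral_integral_featureGap μ ν hα hc hν]
    exact integral_nonneg fun x => integral_nonneg fun z => featureGap_nonneg μ ν hc x z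
  exact sub_nonneg.1 (nonneg_of_mul_nonneg_right h hc)

/-- A probability measure with constant potential is the only minimizer of `sphereLoss`. -/
theorem eq_of_sphereLoss_eq_of_potential_const (hα : 0 < α) {c : ℝ} (hc : 0 < c)
    (μ ν : ProbabilityMeasure (USphere d))
    (hν : ∀ x, ∫ y, sphereKernel α x y ∂(ν : Measure (USphere d)) = c)
    (h : sphereLoss α μ = sphereLoss α ν) : μ = ν := by
  have h0 := integral_integral_featureGap μ ν hα hc hν
  rw [h, sub_self, mul_zero, integral_eq_zero_iff_of_nonneg
    (fun x => integral_nonneg fun z => featureGap_nonneg μ ν hc x z)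
    (integrable_integral_featureGap μ ν hα hc hν)] at h0
  -- A single x suffices: the resulting equality of mean features does not involve x.
  obtain ⟨x, hx⟩ := h0.exists
  have hx' := (integral_eq_zero_iff_of_nonneg (featureGap_nonneg μ ν hc x)
    (integrable_featureGap μ ν hc x)).1 hx
  exact eq_of_meanFeature_ae_eq hα
    (hx'.mono fun z hz => meanFeature_eq_of_featureGap_eq_zero μ ν hc hz)

end Minimization

theorem mainTheorem4 (d : ℕ) (α : ℝ) (hα : 0 < α) (μ : ProbabilityMeasure (USphere d)) :
    (∀ ν : ProbabilityMeasure (USphere d), sphereLoss α μ ≤ sphereLoss α ν) ↔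
      μ = uniformSphere d := by
  obtain ⟨x₀⟩ : Nonempty (USphere d) := (uniformSphere d).nonempty
  have hν := fun x => integral_sphereKernel_uniformSphere α x x₀
  have hc := potential_pos (α := α) (uniformSphere d) x₀
  constructor
  · intro h
    exact eq_of_sphereLoss_eq_of_potential_const hα hc μ _ hν
      ((h _).antisymm (sphereLoss_le_of_potential_const hα hc μ _ hν))
  · rintro rfl ν
    exact sphereLoss_le_of_potential_const hα hc ν _ hν
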